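/- **Notation.** Let $\mathcal K$ be a real Hilbert space. For a set-valued operator $A\colon\mathcal K\to 2^{\mathcal K}$, put $\operatorname{zer}A=\{x: 0\in Ax\}$ and $A^{-1}u=\{x: u\in Ax\}$; the parallel sum is $B\,\square\,D=(B^{-1}+D^{-1})^{-1}$ (sums of sets are Minkowski sums). $A$ is *maximally monotone* if, for all $x,x^*\in\mathcal K$, one has $x^*\in Ax$ if and only if $\langle x-y, x^*-y^*\rangle\ge 0$ for all $y$ and all $y^*\in Ay$; it is *strictly monotone* if $\langle x-y,x^*-y^*\rangle>0$ whenever $x^*\in Ax$, $y^*\in Ay$, $x\ne y$. A map $C\colon\mathcal K\to\mathcal K$ is *cocoercive with constant* $\alpha>0$ if $\langle x-y,Cx-Cy\rangle\ge\alpha\|Cx-Cy\|^2$ for all $x,y$. **Setting.** Let $(\mathcal H_i)_{i\in I}$ and $(\mathcal G_k)_{k\in K}$ be finite families of real Hilbert spaces, $I\ne\varnothing$, with Hilbert direct sums $\mathcal H=\bigoplus_i\mathcal H_i$ and $\mathcal G=\bigoplus_k\mathcal G_k$. For all $i\in I$, $k\in K$ let $s_i^*\in\mathcal H_i$, $r_k\in\mathcal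 G_k$; let $A_i\colon\mathcal H_i\to2^{\mathcal H_i}$ and $B_k^m,D_k^m\colon\mathcal G_k\to 2^{\mathcal G_k}$ be maximally monotone; let $C_i\colon\mathcal H_i\to\mathcal H_i$ and $B_k^c,D_k^c\colon\mathcal G_k\to\mathcal G_k$ be cocoercive; let $Q_i\colon\mathcal H_i\to\mathcal H_i$ and $B_k^l,D_k^l\colon\mathcal G_k\to\mathcal G_k$ be monotone and Lipschitzian; let $L_{ki}\colon\mathcal H_i\to\mathcal G_k$ be bounded and linear; and let $R_i\colon\mathcal H\to\mathcal H_i$ be such that $x\mapsto(R_ix)_{i\in I}$ is monotone and Lipschitzian on $\mathcal H$. Write $B_k=B_k^m+B_k^c+B_k^l$ and $D_k=D_k^m+D_k^c+D_k^l$. Let - $\mathscr P$ be the set of $x\in\mathcal H$ such that $s_i^*\in A_ix_i+C_ix_i+Q_ix_i+R_ix+\sum_{k\in K}L_{ki}^*\big((B_k\,\square\,D_k)(\sum_{j\in I}L_{kj}x_j-r_k)\big)$ for every $i\in I$; - $\mathscr D$ be the set of $v^*\in\mathcal G$ for which there is $x\in\mathcal H$ with $s_i^*-\sum_{k\in K}L_{ki}^*v_k^*\in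 A_ix_i+C_ix_i+Q_ix_i+R_ix$ for every $i\in I$ and $v_k^*\in(B_k\,\square\,D_k)(\sum_{j\in I}L_{kj}x_j-r_k)$ for every $k\in K$; - $\mathsf Z$ be the set of $(x,v^*)\in\mathcal H\oplus\mathcal G$ such that $s_i^*-\sum_{k\in K}L_{ki}^*v_k^*\in A_ix_i+C_ix_i+Q_ix_i+R_ix$ for every $i\in I$ and $\sum_{j\in I}L_{kj}x_j-r_k\in B_k^{-1}v_k^*+D_k^{-1}v_k^*$ for every $k\in K$ (the Kuhn–Tucker set); - $\mathcal S$ be the saddle operator on $\mathcal H\oplus\mathcal G\oplus\mathcal G\oplus\mathcal G$ that maps $(x,y,z,v^*)$ to the product set $$\prod_{i\in I}\Big(-s_i^*+A_ix_i+C_ix_i+Q_ix_i+R_ix+\sum_{k\in K}L_{ki}^*v_k^*\Big)\times\prod_{k\in K}(B_ky_k-v_k^*)\times\prod_{k\in K}(D_kz_k-v_k^*)\times\prod_{k\in K}\Big\{r_k+y_k+z_k-\sum_{i\in I}L_{ki}x_i\Big\}.$$ **Proposition.** The following hold. (i) $\mathcal S$ is maximally monotone. (ii) $\operatorname{zer}\mathcal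 S$ is closed and convex. (iii) If $(x,y,z,v^*)\in\operatorname{zer}\mathcal S$, then $(x,v^*)\in\mathsf Z$; moreover $\mathsf Z\subset\mathscr P\times\mathscr D$. (iv) $\mathscr D\ne\varnothing\Leftrightarrow\operatorname{zer}\mathcal S\ne\varnothing\Leftrightarrow\mathsf Z\ne\varnothing\Rightarrow\mathscr P\ne\varnothing$. (v) Suppose that one of the following holds: [a] $I$ is a singleton; [b] for every $k\in K$, $B_k\,\square\,D_k$ is at most single-valued; [c] for every $k\in K$, $D_k^{-1}$ is strictly monotone; [d] $I$ is (identified through an injection with) a subset of $K$, $B_k\,\square\,D_k$ is at most single-valued for every $k\in K\smallsetminus I$, and $L_{ki}=0$ for all $i,k\in I$ with $k\ne i$. Then $\mathscr P\ne\varnothing\Rightarrow\mathsf Z\ne\varnothing$. -/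

import Mathlib

open scoped Pointwise

noncomputable section

/-! ### Set-valued operators on a real Hilbert space -/

namespace SetOp

/-- The set of zeros of `A : E → 2^F`. -/
def zer {E F : Type*} [Zero F] (A : E → Set F) : Set E :=
  {x | 0 ∈ A x}

/-- The inverse of `A : E → 2^F`. -/
def inverse {E F : Type*} (A : E → Set F) : F → Set E :=
  fun u => {x | u ∈ A x}

/-- A single-valued map seen as a set-valued operator. -/
def ofMap {E F : Type*} (C : E → F) : E → Set F :=
  fun x => {C x}

/-- The parallel sum `(B⁻¹ + D⁻¹)⁻¹`, where `+` is the pointwise Minkowski sum. -/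
def parallelSum {E F : Type*} [Add E] (B D : E → Set F) : E → Set F :=
  inverse (inverse B + inverse D)

/-- Every value has at most one element (values may be empty). -/
def AtMostSingleValued {E F : Type*} (A : E → Set F) : Prop :=
  ∀ x, (A x).Subsingleton

section Hilbert

variable {E : Type*} [NormedAddCommGroup E] [InnerProductSpace ℝ E]

/-- Maximal monotonicity: `(x, u)` is in the graph of `A` exactly when it is monotonically related
to every point of the graph. -/
def MaximallyMonotone (A : E → Set E) : Prop :=
  ∀ x u : E, u ∈ A x ↔ ∀ y v : E, v ∈ A y → 0 ≤ inner ℝ (x - y) (u - v)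

/-- Strict monotonicity of a set-valued operator. -/
def StrictlyMonotone (A : E → Set E) : Prop :=
  ∀ x u y v : E, u ∈ A x → v ∈ A y → x ≠ y → 0 < inner ℝ (x - y) (u - v)

/-- Monotonicity of a single-valued map `C : E → E`. -/
def MonotoneMap (C : E → E) : Prop :=
  ∀ x y : E, 0 ≤ inner ℝ (x - y) (C x - C y)

/-- Cocoercivity of `C : E → E` with constant `α > 0`. -/
def Cocoercive (α : ℝ) (C : E → E) : Prop :=
  0 < α ∧ ∀ x y : E, α * ‖C x - C y‖ ^ 2 ≤ inner ℝ (x - y) (C x - C y)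

end Hilbert

end SetOp

/-! ### The system of monotone inclusions

`PiLp 2 H` and `PiLp 2 G` are the Hilbert direct sums of the families `H` and `G`. -/

/-- The data of the primal-dual system of monotone inclusions, with their standing properties. -/
structure InclusionSystem {I K : Type*} [Fintype I] [Fintype K]
    (H : I → Type*) [∀ i, NormedAddCommGroup (H i)] [∀ i, InnerProductSpace ℝ (H i)]
    (G : K → Type*) [∀ k, NormedAddCommGroup (G k)] [∀ k, InnerProductSpace ℝ (G k)] where
  s : ∀ i, H i
  r : ∀ k, G k
  A : ∀ i, H i → Set (H i)
  C : ∀ i, H i → H i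
  Q : ∀ i, H i → H i
  R : ∀ i, PiLp 2 H → H i
  Bm : ∀ k, G k → Set (G k)
  Bc : ∀ k, G k → G k
  Bl : ∀ k, G k → G k
  Dm : ∀ k, G k → Set (G k)
  Dc : ∀ k, G k → G k
  Dl : ∀ k, G k → G k
  L : ∀ k i, H i →L[ℝ] G k
  αc : I → ℝ
  αl : I → NNReal
  βc : K → ℝ
  βl : K → NNReal
  δc : K → ℝ
  δl : K → NNReal
  χ : NNReal
  A_maximallyMonotone : ∀ i, SetOp.MaximallyMonotone (A i)
  C_cocoercive : ∀ i, SetOp.Cocoercive (αc i) (C i)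
  Q_monotone : ∀ i, SetOp.MonotoneMap (Q i)
  Q_lipschitz : ∀ i, LipschitzWith (αl i) (Q i)
  Bm_maximallyMonotone : ∀ k, SetOp.MaximallyMonotone (Bm k)
  Bc_cocoercive : ∀ k, SetOp.Cocoercive (βc k) (Bc k)
  Bl_monotone : ∀ k, SetOp.MonotoneMap (Bl k)
  Bl_lipschitz : ∀ k, LipschitzWith (βl k) (Bl k)
  Dm_maximallyMonotone : ∀ k, SetOp.MaximallyMonotone (Dm k)
  Dc_cocoercive : ∀ k, SetOp.Cocoercive (δc k) (Dc k)
  Dl_monotone : ∀ k, SetOp.MonotoneMap (Dl k)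
  Dl_lipschitz : ∀ k, LipschitzWith (δl k) (Dl k)
  R_monotone : SetOp.MonotoneMap (fun x : PiLp 2 H => WithLp.toLp 2 (fun i => R i x))
  R_lipschitz : LipschitzWith χ (fun x : PiLp 2 H => WithLp.toLp 2 (fun i => R i x))

namespace InclusionSystem

variable {I K : Type*} [Fintype I] [Fintype K]
  {H : I → Type*} [∀ i, NormedAddCommGroup (H i)] [∀ i, InnerProductSpace ℝ (H i)]
  {G : K → Type*} [∀ k, NormedAddCommGroup (G k)] [∀ k, InnerProductSpace ℝ (G k)]

/-- `A_i x_i + C_i x_i + Q_i x_i + R_i x`, as a subset of `H i`. -/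
def primalOp (M : InclusionSystem H G) (x : PiLp 2 H) (i : I) : Set (H i) :=
  M.A i (x i) + {M.C i (x i)} + {M.Q i (x i)} + {M.R i x}

/-- `Bᵐ_k + Bᶜ_k + Bˡ_k`. -/
def B (M : InclusionSystem H G) (k : K) : G k → Set (G k) :=
  M.Bm k + SetOp.ofMap (M.Bc k) + SetOp.ofMap (M.Bl k)

/-- `Dᵐ_k + Dᶜ_k + Dˡ_k`. -/
def D (M : InclusionSystem H G) (k : K) : G k → Set (G k) :=
  M.Dm k + SetOp.ofMap (M.Dc k) + SetOp.ofMap (M.Dl k)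

/-- `∑ j, L_kj x_j`. -/
def sumL (M : InclusionSystem H G) (x : PiLp 2 H) (k : K) : G k :=
  ∑ j, M.L k j (x j)

/-- The Hilbert direct sum `H ⊕ G ⊕ G ⊕ G`; its points are written
`⟨x, y, z, v⟩` with `x = p.fst`, `y = p.snd.fst`, `z = p.snd.snd.fst`, `v = p.snd.snd.snd`. -/
abbrev SaddleSpace (H : I → Type*) [∀ i, NormedAddCommGroup (H i)]
    [∀ i, InnerProductSpace ℝ (H i)]
    (G : K → Type*) [∀ k, NormedAddCommGroup (G k)] [∀ k, InnerProductSpace ℝ (G k)] :=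
  WithLp 2 (PiLp 2 H × WithLp 2 (PiLp 2 G × WithLp 2 (PiLp 2 G × PiLp 2 G)))

variable [∀ i, CompleteSpace (H i)] [∀ k, CompleteSpace (G k)]

/-- `∑ k, L_ki^* v_k`. -/
def sumLAdj (M : InclusionSystem H G) (v : PiLp 2 G) (i : I) : H i :=
  ∑ k, ContinuousLinearMap.adjoint (M.L k i) (v k)

/-- The set of solutions of the primal problem. The sum over `k` is a Minkowski sum of sets. -/
def primalSolutions (M : InclusionSystem H G) : Set (PiLp 2 H) :=
  {x | ∀ i, M.s i ∈ M.primalOp x i +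
    ∑ k, ContinuousLinearMap.adjoint (M.L k i) ''
      SetOp.parallelSum (M.B k) (M.D k) (M.sumL x k - M.r k)}

/-- The set of solutions of the dual problem. -/
def dualSolutions (M : InclusionSystem H G) : Set (PiLp 2 G) :=
  {v | ∃ x : PiLp 2 H, (∀ i, M.s i - M.sumLAdj v i ∈ M.primalOp x i) ∧
    ∀ k, v k ∈ SetOp.parallelSum (M.B k) (M.D k) (M.sumL x k - M.r k)}

/-- The Kuhn–Tucker set, as a set of pairs `(x, v)`. -/
def kuhnTucker (M : InclusionSystem H G) : Set (PiLp 2 H × PiLp 2 G) :=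
  {p | (∀ i, M.s i - M.sumLAdj p.2 i ∈ M.primalOp p.1 i) ∧
    ∀ k, M.sumL p.1 k - M.r k ∈
      SetOp.inverse (M.B k) (p.2 k) + SetOp.inverse (M.D k) (p.2 k)}

/-- The saddle operator on `H ⊕ G ⊕ G ⊕ G`: `q` belongs to its value at `p = (x, y, z, v)` when
each component of `q` belongs to the corresponding factor of the product set. -/
def saddle (M : InclusionSystem H G) (p : SaddleSpace H G) : Set (SaddleSpace H G) :=
  let x := p.fst
  let y := p.snd.fst
  let z := p.snd.snd.fst
  let v := p.snd.snd.snd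
  {q | (∀ i, q.fst i ∈ {-M.s i} + M.primalOp x i + {M.sumLAdj v i}) ∧
    (∀ k, q.snd.fst k ∈ M.B k (y k) + {-v k}) ∧
    (∀ k, q.snd.snd.fst k ∈ M.D k (z k) + {-v k}) ∧
    ∀ k, q.snd.snd.snd k = M.r k + y k + z k - M.sumL x k}

end InclusionSystem

end


/-! Write `F` for the Fitzpatrick function of a maximally monotone `A`, the supremum of
`(x, u) ↦ ⟪y, u⟫ + ⟪x, v⟫ - ⟪y, v⟫` over the graph of `A`. Then `F (x, u) ≥ ⟪x, u⟫`, with equality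
on the graph, so `F` lies above the concave function `-½‖·‖²`. A continuous affine function
separating the two supplies a point of the graph of the form `(x, -x)`; this is Minty's theorem.
Solving `w ∈ A y + μ y` with `μ` large shows that a maximally monotone operator remains so after
the addition of a monotone one-sided Lipschitz map. The saddle operator is a product of maximally
monotone operators plus an affine map with skew linear part, hence maximally monotone, and its
zeros form an intersection of closed half-spaces.

A primal solution `x` provides dual vectors `w i k` that may depend on `i`. It extends to a
Kuhn–Tucker point as soon as each `k` has an index `f k` such that `w (f k) k` can replace `w i k`
under `L k i^*` for every `i`, which each of the four conditions in (v) guarantees. -/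

namespace SetOp

section Separation

variable {F : Type*} [NormedAddCommGroup F]

theorem concaveOn_neg_half_norm_sq [NormedSpace ℝ F] :
    ConcaveOn ℝ Set.univ fun z : F => -(‖z‖ ^ 2 / 2) := by
  refine ConvexOn.neg ?_
  simpa only [div_eq_inv_mul, smul_eq_mul, Pi.pow_apply] using
    (convexOn_univ_norm.pow (fun z _ => norm_nonneg z) 2).smul (by norm_num : (0 : ℝ) ≤ 2⁻¹)

theorem exists_half_norm_sq_le_inner_add [InnerProductSpace ℝ F] [CompleteSpace F]
    {S : Set (F × ℝ)} (hconv : Convex ℝ S) (hne : S.Nonempty)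
    (hS : ∀ p ∈ S, -(‖p.1‖ ^ 2 / 2) ≤ p.2) :
    ∃ b : F, ∀ p ∈ S, ‖b‖ ^ 2 / 2 ≤ inner ℝ b p.1 + p.2 := by
  let U : Set (F × ℝ) := {p | p.1 ∈ Set.univ ∧ p.2 < -(‖p.1‖ ^ 2 / 2)}
  have hU_open : IsOpen U := by
    simp only [U, Set.mem_univ, true_and]
    exact isOpen_lt (by fun_prop) (by fun_prop)
  have hdisj : Disjoint U S := Set.disjoint_left.2 fun p hpU hpS => (hS p hpS).not_gt hpU.2
  obtain ⟨f, c, hfU, hfS⟩ := geometric_hahn_banach_open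
    concaveOn_neg_half_norm_sq.convex_strict_hypograph hU_open hconv hdisj
  let a : F := (InnerProductSpace.toDual ℝ F).symm (f.comp (.inl ℝ F ℝ))
  let l : ℝ := f (0, 1)
  have hf (z : F) (t : ℝ) : f (z, t) = inner ℝ a z + l * t := by
    have hsplit : (z, t) = (z, 0) + t • ((0, 1) : F × ℝ) := by simp
    rw [hsplit, map_add, map_smul, InnerProductSpace.toDual_symm_apply, smul_eq_mul, mul_comm t]
    rfl
  have hl : 0 < l := by
    obtain ⟨⟨z, t⟩, hzt⟩ := hne
    have hlt := (hfU (z, -(‖z‖ ^ 2 / 2) - 1) ⟨trivial, sub_one_lt _⟩).trans_le (hfS _ hzt)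
    rw [hf, hf, add_lt_add_iff_left] at hlt
    have hzt' := hS _ hzt
    exact pos_of_mul_pos_left (b := t - (-(‖z‖ ^ 2 / 2) - 1)) (by linarith) (by linarith)
  let b : F := l⁻¹ • a
  have ha : a = l • b := (smul_inv_smul₀ hl.ne' a).symm
  have hc : l * (‖b‖ ^ 2 / 2) ≤ c := by
    refine le_of_forall_pos_lt_add fun ε hε => ?_
    have hlt := hfU (b, -(‖b‖ ^ 2 / 2) - ε / l) ⟨trivial, sub_lt_self _ (div_pos hε hl)⟩
    rw [hf, ha, real_inner_smul_left, real_inner_self_eq_norm_sq, mul_sub,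
      mul_div_cancel₀ _ hl.ne'] at hlt
    linarith
  refine ⟨b, fun p hp => le_of_mul_le_mul_left ?_ hl⟩
  calc l * (‖b‖ ^ 2 / 2) ≤ f p := hc.trans (hfS p hp)
    _ = l * (inner ℝ b p.1 + p.2) := by rw [hf, ha, real_inner_smul_left, mul_add]

end Separation

section Hilbert

variable {E : Type*} [NormedAddCommGroup E] [InnerProductSpace ℝ E]

theorem zer_eq_iInter {A : E → Set E} (hA : MaximallyMonotone A) :
    zer A = ⋂ (y) (v) (_ : v ∈ A y), {x | inner ℝ x v ≤ inner ℝ y v} := by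
  ext x
  simp only [zer, Set.mem_ofPred_eq, Set.mem_iInter]
  rw [hA x 0]
  simp only [zero_sub, inner_neg_right, inner_sub_left, neg_sub, sub_nonneg]

/-- The epigraph of the Fitzpatrick function of `A`, which is the supremum of the affine functions
`(x, u) ↦ ⟪y, u⟫ + ⟪x, v⟫ - ⟪y, v⟫` over the points `(y, v)` of the graph of `A`. Working with the
epigraph avoids infinite values. -/
def fitzpatrickEpigraph (A : E → Set E) : Set (WithLp 2 (E × E) × ℝ) :=
  {p | ∀ y v, v ∈ A y → inner ℝ y p.1.snd + inner ℝ p.1.fst v - inner ℝ y v ≤ p.2}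

theorem convex_fitzpatrickEpigraph (A : E → Set E) : Convex ℝ (fitzpatrickEpigraph A) := by
  intro p hp q hq a b ha hb hab y v hv
  have hp' := mul_le_mul_of_nonneg_left (hp y v hv) ha
  have hq' := mul_le_mul_of_nonneg_left (hq y v hv) hb
  simp only [Prod.fst_add, Prod.snd_add, Prod.smul_fst, Prod.smul_snd, WithLp.add_fst,
    WithLp.add_snd, WithLp.smul_fst, WithLp.smul_snd, inner_add_left, inner_add_right,
    real_inner_smul_left, real_inner_smul_right, smul_eq_mul]
  linear_combination hp' + hq' + inner ℝ y v * hab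

namespace MaximallyMonotone

variable {A : E → Set E}

theorem inner_nonneg (hA : MaximallyMonotone A) {x u y v : E} (hu : u ∈ A x) (hv : v ∈ A y) :
    0 ≤ inner ℝ (x - y) (u - v) :=
  (hA x u).1 hu y v hv

theorem exists_inner_nonpos (hA : MaximallyMonotone A) (x u : E) :
    ∃ y v, v ∈ A y ∧ inner ℝ (x - y) (u - v) ≤ 0 ∧
      (inner ℝ (x - y) (u - v) = 0 → u ∈ A x) := by
  by_cases hu : u ∈ A x
  · exact ⟨x, u, hu, by simp, fun _ => hu⟩
  · have hneg := hu
    rw [hA x u] at hneg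
    push Not at hneg
    obtain ⟨y, v, hv, hlt⟩ := hneg
    exact ⟨y, v, hv, hlt.le, fun heq => absurd heq hlt.ne⟩

theorem mk_mem_fitzpatrickEpigraph (hA : MaximallyMonotone A) {x u : E} (hu : u ∈ A x) :
    (WithLp.toLp 2 (x, u), inner ℝ x u) ∈ fitzpatrickEpigraph A := by
  intro y v hv
  have h := hA.inner_nonneg hu hv
  simp only [inner_sub_left, inner_sub_right] at h
  simp only [WithLp.toLp_fst, WithLp.toLp_snd]
  linarith

theorem inner_le_of_mem_fitzpatrickEpigraph (hA : MaximallyMonotone A)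
    {p : WithLp 2 (E × E) × ℝ} (hp : p ∈ fitzpatrickEpigraph A) :
    inner ℝ p.1.fst p.1.snd ≤ p.2 := by
  obtain ⟨y, v, hv, hle, -⟩ := hA.exists_inner_nonpos p.1.fst p.1.snd
  have h := hp y v hv
  simp only [inner_sub_left, inner_sub_right] at hle
  linarith

theorem exists_neg_mem [CompleteSpace E] (hA : MaximallyMonotone A) : ∃ x, -x ∈ A x := by
  have hne : (fitzpatrickEpigraph A).Nonempty := by
    obtain ⟨y, v, hv, -⟩ := hA.exists_inner_nonpos 0 0
    exact ⟨_, hA.mk_mem_fitzpatrickEpigraph hv⟩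
  have hquad : ∀ p ∈ fitzpatrickEpigraph A, -(‖p.1‖ ^ 2 / 2) ≤ p.2 := by
    intro p hp
    have hinner := hA.inner_le_of_mem_fitzpatrickEpigraph hp
    have hsq := norm_add_sq_real p.1.fst p.1.snd
    rw [WithLp.prod_norm_sq_eq_of_L2]
    linarith [sq_nonneg ‖p.1.fst + p.1.snd‖]
  obtain ⟨b, hb⟩ := exists_half_norm_sq_le_inner_add (convex_fitzpatrickEpigraph A) hne hquad
  have hgraph : ∀ y v, v ∈ A y →
      ‖b.fst + b.snd‖ ^ 2 / 2 ≤ inner ℝ (-b.snd - y) (-b.fst - v) := by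
    intro y v hv
    have h : (‖b.fst‖ ^ 2 + ‖b.snd‖ ^ 2) / 2
        ≤ inner ℝ b.fst y + inner ℝ b.snd v + inner ℝ y v := by
      have h := hb _ (hA.mk_mem_fitzpatrickEpigraph hv)
      rwa [WithLp.prod_norm_sq_eq_of_L2, WithLp.prod_inner_apply] at h
    simp only [norm_add_sq_real, inner_sub_left, inner_sub_right, inner_neg_left, inner_neg_right,
      real_inner_comm b.fst]
    linarith
  have hmem : -b.fst ∈ A (-b.snd) :=
    (hA _ _).2 fun y v hv => (by positivity : (0 : ℝ) ≤ _).trans (hgraph y v hv)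
  have hsum : b.fst + b.snd = 0 := by
    have h := hgraph _ _ hmem
    rw [sub_self, inner_zero_left] at h
    exact norm_eq_zero.1 (pow_eq_zero_iff two_ne_zero |>.1
      (by linarith [sq_nonneg ‖b.fst + b.snd‖]))
  exact ⟨b.fst, by rwa [neg_eq_of_add_eq_zero_left hsum] at hmem⟩

theorem preimage_smul_add (hA : MaximallyMonotone A) {μ : ℝ} (hμ : 0 < μ) (w : E) :
    MaximallyMonotone fun x => (fun u => μ • u + w) ⁻¹' A x := by
  have hinner (x u y v : E) :
      inner ℝ (x - y) (μ • u + w - (μ • v + w)) = μ * inner ℝ (x - y) (u - v) := by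
    rw [add_sub_add_right_eq_sub, ← smul_sub, real_inner_smul_right]
  refine fun x u => ⟨fun hu y v hv => ?_, fun h => (hA x _).2 fun y v hv => ?_⟩
  · have hnonneg := hA.inner_nonneg hu hv
    rwa [hinner, mul_nonneg_iff_of_pos_left hμ] at hnonneg
  · obtain ⟨v, rfl⟩ : ∃ v', μ • v' + w = v :=
      ⟨μ⁻¹ • (v - w), by rw [smul_inv_smul₀ hμ.ne', sub_add_cancel]⟩
    rw [hinner, mul_nonneg_iff_of_pos_left hμ]
    exact h y v hv

theorem exists_mem_add_smul_eq [CompleteSpace E] (hA : MaximallyMonotone A) {μ : ℝ} (hμ : 0 < μ)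
    (w : E) : ∃ y, ∃ v ∈ A y, v + μ • y = w := by
  obtain ⟨y, hy⟩ := (hA.preimage_smul_add hμ w).exists_neg_mem
  exact ⟨y, μ • -y + w, hy, by rw [smul_neg]; abel⟩

theorem isClosed_zer (hA : MaximallyMonotone A) : IsClosed (zer A) := by
  rw [zer_eq_iInter hA]
  exact isClosed_iInter fun y => isClosed_iInter fun v => isClosed_iInter fun _ =>
    isClosed_le (by fun_prop) continuous_const

theorem convex_zer (hA : MaximallyMonotone A) : Convex ℝ (zer A) := by
  rw [zer_eq_iInter hA]
  exact convex_iInter fun y => convex_iInter fun v => convex_iInter fun _ =>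
    convex_halfSpace_le ⟨fun _ _ => inner_add_left .., fun _ _ => real_inner_smul_left ..⟩ _

end MaximallyMonotone

theorem mem_add_singleton_iff {V : Type*} [AddCommGroup V] {S : Set V} {a u : V} :
    u ∈ S + {a} ↔ u - a ∈ S := by
  simp only [Set.add_singleton, Set.mem_image, ← eq_sub_iff_add_eq, exists_eq_right]

theorem mem_add_ofMap_iff {X V : Type*} [AddCommGroup V] {A : X → Set V} {T : X → V} {x : X}
    {u : V} : u ∈ (A + ofMap T) x ↔ u - T x ∈ A x :=
  mem_add_singleton_iff

namespace MaximallyMonotone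

variable {A : E → Set E}

theorem add_ofMap [CompleteSpace E] (hA : MaximallyMonotone A) {T : E → E} (hT : MonotoneMap T)
    {c : ℝ} (hc : ∀ x y, inner ℝ (x - y) (T x - T y) ≤ c * ‖x - y‖ ^ 2) :
    MaximallyMonotone (A + ofMap T) := by
  have hinner (x u y v : E) : inner ℝ (x - y) (u - v)
      = inner ℝ (x - y) (u - T x - (v - T y)) + inner ℝ (x - y) (T x - T y) := by
    rw [← inner_add_right, sub_sub_sub_comm, sub_add_cancel]
  refine fun x u => ⟨fun hu y v hv => ?_, fun h => ?_⟩
  · rw [hinner]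
    exact add_nonneg (hA.inner_nonneg (mem_add_ofMap_iff.1 hu) (mem_add_ofMap_iff.1 hv)) (hT x y)
  obtain ⟨y, v, hv, hyv⟩ :=
    hA.exists_mem_add_smul_eq (by positivity : 0 < |c| + 1) (u - T x + (|c| + 1) • x)
  have hres : u - T x - v = -((|c| + 1) • (x - y)) := by
    rw [eq_sub_of_add_eq hyv, smul_sub]
    abel
  have hnonneg : 0 ≤ -((|c| + 1) * ‖x - y‖ ^ 2) + inner ℝ (x - y) (T x - T y) := by
    have hrel := h y (v + T y) (mem_add_ofMap_iff.2 (by rwa [add_sub_cancel_right]))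
    rwa [hinner, add_sub_cancel_right, hres, inner_neg_right, real_inner_smul_right,
      real_inner_self_eq_norm_sq] at hrel
  have hxy : x = y := by
    have hsq : ‖x - y‖ ^ 2 ≤ 0 := by nlinarith [hc x y, le_abs_self c, sq_nonneg ‖x - y‖]
    exact sub_eq_zero.1 (norm_eq_zero.1 (pow_eq_zero_iff two_ne_zero |>.1
      (hsq.antisymm (sq_nonneg _))))
  subst hxy
  rw [sub_self, smul_zero, neg_zero, sub_eq_zero] at hres
  exact mem_add_ofMap_iff.2 (hres ▸ hv)

theorem add_ofMap_of_lipschitzWith [CompleteSpace E] (hA : MaximallyMonotone A) {T : E → E}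
    (hT : MonotoneMap T) {β : NNReal} (hβ : LipschitzWith β T) :
    MaximallyMonotone (A + ofMap T) := by
  refine hA.add_ofMap hT (c := β) fun x y => (real_inner_le_norm _ _).trans ?_
  calc ‖x - y‖ * ‖T x - T y‖ ≤ ‖x - y‖ * (β * ‖x - y‖) := by gcongr; exact hβ.norm_sub_le x y
    _ = β * ‖x - y‖ ^ 2 := by ring

theorem zero : MaximallyMonotone (0 : E → Set E) := by
  refine fun x u => ⟨?_, fun h => ?_⟩
  · rintro rfl y v rfl
    simp
  · have hneg : 0 ≤ -(‖u‖ ^ 2) := by simpa using h (x + u) 0 rfl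
    exact norm_eq_zero.1 (pow_eq_zero_iff two_ne_zero |>.1 (by linarith [sq_nonneg ‖u‖]))

theorem prod {F : Type*} [NormedAddCommGroup F] [InnerProductSpace ℝ F] {B : F → Set F}
    (hA : MaximallyMonotone A) (hB : MaximallyMonotone B) :
    MaximallyMonotone fun p : WithLp 2 (E × F) =>
      {q : WithLp 2 (E × F) | q.fst ∈ A p.fst ∧ q.snd ∈ B p.snd} := by
  refine fun p q => ⟨fun hq p' q' hq' => ?_, fun h => ?_⟩
  · rw [WithLp.prod_inner_apply]
    exact add_nonneg (hA.inner_nonneg hq.1 hq'.1) (hB.inner_nonneg hq.2 hq'.2)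
  · obtain ⟨y, v, hv, hle_fst, hmem_fst⟩ := hA.exists_inner_nonpos p.fst q.fst
    obtain ⟨z, w, hw, hle_snd, hmem_snd⟩ := hB.exists_inner_nonpos p.snd q.snd
    have hsum : 0 ≤ inner ℝ (p.fst - y) (q.fst - v) + inner ℝ (p.snd - z) (q.snd - w) :=
      (h (WithLp.toLp 2 (y, z)) (WithLp.toLp 2 (v, w)) ⟨hv, hw⟩).trans_eq
        (WithLp.prod_inner_apply _ _)
    exact ⟨hmem_fst (by linarith), hmem_snd (by linarith)⟩

theorem pi {ι : Type*} [Fintype ι] {V : ι → Type*} [∀ i, NormedAddCommGroup (V i)]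
    [∀ i, InnerProductSpace ℝ (V i)] {A : ∀ i, V i → Set (V i)}
    (hA : ∀ i, MaximallyMonotone (A i)) :
    MaximallyMonotone fun p : PiLp 2 V => {q : PiLp 2 V | ∀ i, q i ∈ A i (p i)} := by
  refine fun p q => ⟨fun hq p' q' hq' => ?_, fun h => ?_⟩
  · rw [PiLp.inner_apply]
    exact Finset.sum_nonneg fun i _ => (hA i).inner_nonneg (hq i) (hq' i)
  · choose y v hv hle hmem using fun i => (hA i).exists_inner_nonpos (p i) (q i)
    have hsum : 0 ≤ ∑ i, inner ℝ (p i - y i) (q i - v i) :=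
      (h (WithLp.toLp 2 y) (WithLp.toLp 2 v) hv).trans_eq (PiLp.inner_apply _ _)
    have hzero := (Finset.sum_eq_zero_iff_of_nonpos fun i _ => hle i).1
      (hsum.antisymm' (Finset.sum_nonpos fun i _ => hle i))
    exact fun i => hmem i (hzero i (Finset.mem_univ i))

end MaximallyMonotone

namespace Cocoercive

variable {α : ℝ} {C : E → E}

theorem monotoneMap (hC : Cocoercive α C) : MonotoneMap C :=
  fun x y => (mul_nonneg hC.1.le (sq_nonneg _)).trans (hC.2 x y)

theorem lipschitzWith (hC : Cocoercive α C) : LipschitzWith (Real.toNNReal α⁻¹) C := by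
  refine LipschitzWith.of_dist_le' fun x y => ?_
  rw [dist_eq_norm, dist_eq_norm, ← div_eq_inv_mul, le_div_iff₀ hC.1]
  rcases (norm_nonneg (C x - C y)).eq_or_lt with hzero | hpos
  · rw [← hzero, zero_mul]
    exact norm_nonneg _
  · refine le_of_mul_le_mul_right ?_ hpos
    calc ‖C x - C y‖ * α * ‖C x - C y‖ = α * ‖C x - C y‖ ^ 2 := by ring
      _ ≤ ‖x - y‖ * ‖C x - C y‖ := (hC.2 x y).trans (real_inner_le_norm _ _)

end Cocoercive

theorem MaximallyMonotone.add_cocoercive_add_lipschitz [CompleteSpace E] {A : E → Set E}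
    (hA : MaximallyMonotone A) {C Q : E → E} {α : ℝ} {β : NNReal} (hC : Cocoercive α C)
    (hQ : MonotoneMap Q) (hβ : LipschitzWith β Q) :
    MaximallyMonotone (A + ofMap C + ofMap Q) :=
  (hA.add_ofMap_of_lipschitzWith hC.monotoneMap hC.lipschitzWith).add_ofMap_of_lipschitzWith hQ hβ

theorem MaximallyMonotone.atMostSingleValued_parallelSum {B D : E → Set E}
    (hB : MaximallyMonotone B) (hD : StrictlyMonotone (inverse D)) :
    AtMostSingleValued (parallelSum B D) := by
  rintro w v ⟨y, hy, z, hz, hyz⟩ v' ⟨y', hy', z', hz', hyz'⟩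
  by_contra hne
  have hB_nonneg : 0 ≤ inner ℝ (y - y') (v - v') := hB.inner_nonneg hy hy'
  have hD_pos : 0 < inner ℝ (v - v') (z - z') := hD v z v' z' hz hz' hne
  have hyy' : y - y' = -(z - z') := by
    rw [eq_neg_iff_add_eq_zero, sub_add_sub_comm, sub_eq_zero]
    exact hyz.trans hyz'.symm
  rw [hyy', inner_neg_left, real_inner_comm] at hB_nonneg
  linarith

end Hilbert

end SetOp

namespace InclusionSystem

open SetOp

variable {I K : Type*} [Fintype I] [Fintype K]
  {H : I → Type*} [∀ i, NormedAddCommGroup (H i)] [∀ i, InnerProductSpace ℝ (H i)]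
  {G : K → Type*} [∀ k, NormedAddCommGroup (G k)] [∀ k, InnerProductSpace ℝ (G k)]

theorem sumL_sub (M : InclusionSystem H G) (x x' : PiLp 2 H) (k : K) :
    M.sumL (x - x') k = M.sumL x k - M.sumL x' k := by
  simp only [sumL, PiLp.sub_apply, map_sub, Finset.sum_sub_distrib]

theorem primalOp_maximallyMonotone [∀ i, CompleteSpace (H i)] (M : InclusionSystem H G) :
    MaximallyMonotone fun x => {u : PiLp 2 H | ∀ i, u i ∈ M.primalOp x i} := by
  have hpi := MaximallyMonotone.pi fun i =>
    (M.A_maximallyMonotone i).add_cocoercive_add_lipschitz (M.C_cocoercive i) (M.Q_monotone i)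
      (M.Q_lipschitz i)
  convert hpi.add_ofMap_of_lipschitzWith M.R_monotone M.R_lipschitz using 1
  ext x u
  rw [mem_add_ofMap_iff]
  exact forall_congr' fun i => mem_add_singleton_iff

section CompleteG

variable [∀ k, CompleteSpace (G k)]

theorem B_maximallyMonotone (M : InclusionSystem H G) (k : K) : MaximallyMonotone (M.B k) :=
  (M.Bm_maximallyMonotone k).add_cocoercive_add_lipschitz (M.Bc_cocoercive k) (M.Bl_monotone k)
    (M.Bl_lipschitz k)

theorem D_maximallyMonotone (M : InclusionSystem H G) (k : K) : MaximallyMonotone (M.D k) :=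
  (M.Dm_maximallyMonotone k).add_cocoercive_add_lipschitz (M.Dc_cocoercive k) (M.Dl_monotone k)
    (M.Dl_lipschitz k)

end CompleteG

/-- The part of the saddle operator that acts on each of the four components separately. -/
def decoupled (M : InclusionSystem H G) (p : SaddleSpace H G) : Set (SaddleSpace H G) :=
  {q | (∀ i, q.fst i ∈ M.primalOp p.fst i) ∧ (∀ k, q.snd.fst k ∈ M.B k (p.snd.fst k)) ∧
    (∀ k, q.snd.snd.fst k ∈ M.D k (p.snd.snd.fst k)) ∧ q.snd.snd.snd = 0}

/-- The value `(-s, 0, 0, r)` at the origin of the affine part of the saddle operator. -/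
noncomputable def offset (M : InclusionSystem H G) : SaddleSpace H G :=
  WithLp.toLp 2 (WithLp.toLp 2 (-M.s), WithLp.toLp 2 (0, WithLp.toLp 2 (0, WithLp.toLp 2 M.r)))

variable [∀ i, CompleteSpace (H i)] [∀ k, CompleteSpace (G k)]

theorem decoupled_maximallyMonotone (M : InclusionSystem H G) : MaximallyMonotone M.decoupled :=
  M.primalOp_maximallyMonotone.prod
    ((MaximallyMonotone.pi M.B_maximallyMonotone).prod
      ((MaximallyMonotone.pi M.D_maximallyMonotone).prod (MaximallyMonotone.zero (E := PiLp 2 G))))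

theorem sumLAdj_sub (M : InclusionSystem H G) (v v' : PiLp 2 G) (i : I) :
    M.sumLAdj (v - v') i = M.sumLAdj v i - M.sumLAdj v' i := by
  simp only [sumLAdj, PiLp.sub_apply, map_sub, Finset.sum_sub_distrib]

theorem sum_inner_sumLAdj (M : InclusionSystem H G) (x : PiLp 2 H) (v : PiLp 2 G) :
    ∑ i, inner ℝ (x i) (M.sumLAdj v i) = ∑ k, inner ℝ (v k) (M.sumL x k) := by
  simp only [sumLAdj, sumL, inner_sum, ContinuousLinearMap.adjoint_inner_right]
  rw [Finset.sum_comm]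
  simp only [real_inner_comm]

/-- The skew linear part `(x, y, z, v) ↦ (L^* v, -v, -v, y + z - L x)` of the saddle operator. It
contains all the coupling between the four components. -/
noncomputable def skew (M : InclusionSystem H G) (p : SaddleSpace H G) : SaddleSpace H G :=
  WithLp.toLp 2 (WithLp.toLp 2 (M.sumLAdj p.snd.snd.snd),
    WithLp.toLp 2 (-p.snd.snd.snd, WithLp.toLp 2 (-p.snd.snd.snd,
      p.snd.fst + p.snd.snd.fst - WithLp.toLp 2 (M.sumL p.fst))))

theorem skew_sub (M : InclusionSystem H G) (p q : SaddleSpace H G) :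
    M.skew (p - q) = M.skew p - M.skew q := by
  have hsumL : M.sumL (p.fst - q.fst) = M.sumL p.fst - M.sumL q.fst := funext (M.sumL_sub _ _)
  have hsumLAdj : M.sumLAdj (p.snd.snd.snd - q.snd.snd.snd)
      = M.sumLAdj p.snd.snd.snd - M.sumLAdj q.snd.snd.snd := funext (M.sumLAdj_sub _ _)
  simp only [skew, WithLp.sub_fst, WithLp.sub_snd, hsumL, hsumLAdj, ← WithLp.toLp_sub,
    Prod.mk_sub_mk, neg_sub_neg, neg_sub, sub_sub_sub_comm, add_sub_add_comm]

theorem inner_skew_self (M : InclusionSystem H G) (p : SaddleSpace H G) :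
    inner ℝ p (M.skew p) = 0 := by
  have hadj : inner ℝ p.fst (WithLp.toLp 2 (M.sumLAdj p.snd.snd.snd))
      = inner ℝ p.snd.snd.snd (WithLp.toLp 2 (M.sumL p.fst)) := by
    rw [PiLp.inner_apply, PiLp.inner_apply]
    exact M.sum_inner_sumLAdj _ _
  calc inner ℝ p (M.skew p)
      = inner ℝ p.fst (WithLp.toLp 2 (M.sumLAdj p.snd.snd.snd))
        + (inner ℝ p.snd.fst (-p.snd.snd.snd) + (inner ℝ p.snd.snd.fst (-p.snd.snd.snd)
          + inner ℝ p.snd.snd.snd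
            (p.snd.fst + p.snd.snd.fst - WithLp.toLp 2 (M.sumL p.fst)))) := by
        rw [WithLp.prod_inner_apply, WithLp.prod_inner_apply, WithLp.prod_inner_apply]
        rfl
    _ = 0 := by
        rw [hadj, inner_neg_right, inner_neg_right, inner_sub_right, inner_add_right,
          real_inner_comm p.snd.fst, real_inner_comm p.snd.snd.fst]
        ring

theorem saddle_eq_decoupled_add (M : InclusionSystem H G) :
    M.saddle = M.decoupled + ofMap fun p => M.offset + M.skew p := by
  ext p q
  rw [mem_add_ofMap_iff]
  refine and_congr (forall_congr' fun i => ?_) (and_congr (forall_congr' fun k => ?_)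
    (and_congr (forall_congr' fun k => ?_) ?_))
  · rw [add_comm {-M.s i}, add_assoc, Set.singleton_add_singleton]
    exact mem_add_singleton_iff
  · rw [mem_add_singleton_iff, ← zero_add (-_)]
    rfl
  · rw [mem_add_singleton_iff, ← zero_add (-_)]
    rfl
  · change _ ↔ q.snd.snd.snd - (M.offset + M.skew p).snd.snd.snd = 0
    rw [sub_eq_zero, PiLp.ext_iff]
    refine forall_congr' fun k => ?_
    rw [add_assoc, add_sub_assoc]
    rfl

theorem saddle_maximallyMonotone (M : InclusionSystem H G) : MaximallyMonotone M.saddle := by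
  have hskew (p q : SaddleSpace H G) :
      inner ℝ (p - q) (M.offset + M.skew p - (M.offset + M.skew q)) = 0 := by
    rw [add_sub_add_left_eq_sub, ← skew_sub, inner_skew_self]
  rw [saddle_eq_decoupled_add]
  exact M.decoupled_maximallyMonotone.add_ofMap (c := 0) (fun p q => (hskew p q).ge)
    fun p q => by rw [hskew, zero_mul]

theorem mem_zer_saddle_iff (M : InclusionSystem H G) (p : SaddleSpace H G) :
    p ∈ zer M.saddle ↔
      (∀ i, M.s i - M.sumLAdj p.snd.snd.snd i ∈ M.primalOp p.fst i) ∧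
      (∀ k, p.snd.snd.snd k ∈ M.B k (p.snd.fst k)) ∧
      (∀ k, p.snd.snd.snd k ∈ M.D k (p.snd.snd.fst k)) ∧
      ∀ k, p.snd.fst k + p.snd.snd.fst k = M.sumL p.fst k - M.r k := by
  refine and_congr (forall_congr' fun i => ?_) (and_congr (forall_congr' fun k => ?_)
    (and_congr (forall_congr' fun k => ?_) (forall_congr' fun k => ?_)))
  · change (0 : H i) ∈ _ ↔ _
    rw [add_comm {-M.s i}, add_assoc, Set.singleton_add_singleton, mem_add_singleton_iff,
      zero_sub, neg_add_rev, neg_neg, neg_add_eq_sub]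
  · change (0 : G k) ∈ _ ↔ _
    rw [mem_add_singleton_iff, zero_sub, neg_neg]
  · change (0 : G k) ∈ _ ↔ _
    rw [mem_add_singleton_iff, zero_sub, neg_neg]
  · change (0 : G k) = _ ↔ _
    rw [eq_comm, sub_eq_zero, eq_sub_iff_add_eq, add_comm _ (M.r k), add_assoc]

theorem mem_kuhnTucker_of_mem_zer_saddle (M : InclusionSystem H G) {p : SaddleSpace H G}
    (hp : p ∈ zer M.saddle) : (p.fst, p.snd.snd.snd) ∈ M.kuhnTucker := by
  obtain ⟨hx, hy, hz, hyz⟩ := (M.mem_zer_saddle_iff p).1 hp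
  exact ⟨hx, fun k => ⟨_, hy k, _, hz k, hyz k⟩⟩

theorem kuhnTucker_subset_prod (M : InclusionSystem H G) :
    M.kuhnTucker ⊆ M.primalSolutions ×ˢ M.dualSolutions := by
  rintro ⟨x, v⟩ ⟨hx, hv⟩
  refine ⟨fun i => ⟨_, hx i, M.sumLAdj v i, ?_, sub_add_cancel _ _⟩, x, hx, hv⟩
  exact Set.finsetSum_mem_finsetSum _ _ _ fun k _ => Set.mem_image_of_mem _ (hv k)

theorem kuhnTucker_nonempty_of_dualSolutions_nonempty (M : InclusionSystem H G)
    (h : M.dualSolutions.Nonempty) : M.kuhnTucker.Nonempty :=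
  let ⟨v, x, hx, hv⟩ := h
  ⟨(x, v), hx, hv⟩

theorem zer_saddle_nonempty_iff (M : InclusionSystem H G) :
    (zer M.saddle).Nonempty ↔ M.kuhnTucker.Nonempty := by
  refine ⟨fun ⟨p, hp⟩ => ⟨_, M.mem_kuhnTucker_of_mem_zer_saddle hp⟩, ?_⟩
  rintro ⟨⟨x, v⟩, hx, hv⟩
  choose y hy z hz hyz using hv
  exact ⟨WithLp.toLp 2 (x, WithLp.toLp 2 (WithLp.toLp 2 y, WithLp.toLp 2 (WithLp.toLp 2 z, v))),
    (M.mem_zer_saddle_iff _).2 ⟨hx, hy, hz, hyz⟩⟩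

theorem exists_mem_parallelSum_of_mem_primalSolutions (M : InclusionSystem H G) {x : PiLp 2 H}
    (hx : x ∈ M.primalSolutions) (i : I) :
    ∃ w : ∀ k, G k, (∀ k, w k ∈ parallelSum (M.B k) (M.D k) (M.sumL x k - M.r k)) ∧
      M.s i - ∑ k, ContinuousLinearMap.adjoint (M.L k i) (w k) ∈ M.primalOp x i := by
  obtain ⟨a, ha, c, hc, hac⟩ := hx i
  obtain ⟨g, hg, rfl⟩ := (Set.mem_fintype_sum _ _).1 hc
  choose w hw hwg using hg
  refine ⟨w, hw, ?_⟩
  simp only [hwg]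
  rwa [← hac, add_sub_cancel_right]

theorem kuhnTucker_nonempty_of_subsingleton_image_adjoint (M : InclusionSystem H G) (f : K → I)
    (hf : ∀ i k, f k ≠ i → ∀ u,
      (ContinuousLinearMap.adjoint (M.L k i) '' parallelSum (M.B k) (M.D k) u).Subsingleton)
    (hP : M.primalSolutions.Nonempty) : M.kuhnTucker.Nonempty := by
  obtain ⟨x, hx⟩ := hP
  choose w hw hws using M.exists_mem_parallelSum_of_mem_primalSolutions hx
  have hadj (i : I) (k : K) : ContinuousLinearMap.adjoint (M.L k i) (w (f k) k)
      = ContinuousLinearMap.adjoint (M.L k i) (w i k) := by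
    by_cases hi : f k = i
    · rw [hi]
    · exact hf i k hi _ (Set.mem_image_of_mem _ (hw _ k)) (Set.mem_image_of_mem _ (hw i k))
  refine ⟨(x, WithLp.toLp 2 fun k => w (f k) k), fun i => ?_, fun k => hw _ k⟩
  simpa only [sumLAdj, hadj] using hws i

theorem kuhnTucker_nonempty_of_subsingleton [Nonempty I] [Subsingleton I]
    (M : InclusionSystem H G) (hP : M.primalSolutions.Nonempty) : M.kuhnTucker.Nonempty :=
  M.kuhnTucker_nonempty_of_subsingleton_image_adjoint (fun _ => Classical.arbitrary I)
    (fun _ _ hne => absurd (Subsingleton.elim _ _) hne) hP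

theorem kuhnTucker_nonempty_of_atMostSingleValued [Nonempty I] (M : InclusionSystem H G)
    (h : ∀ k, AtMostSingleValued (parallelSum (M.B k) (M.D k)))
    (hP : M.primalSolutions.Nonempty) : M.kuhnTucker.Nonempty :=
  M.kuhnTucker_nonempty_of_subsingleton_image_adjoint (fun _ => Classical.arbitrary I)
    (fun _ k _ u => (h k u).image _) hP

theorem kuhnTucker_nonempty_of_embedding [Nonempty I] (M : InclusionSystem H G) (e : I ↪ K)
    (h : ∀ k, k ∉ Set.range e → AtMostSingleValued (parallelSum (M.B k) (M.D k)))
    (hL : ∀ i j : I, j ≠ i → M.L (e j) i = 0) (hP : M.primalSolutions.Nonempty) :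
    M.kuhnTucker.Nonempty := by
  refine M.kuhnTucker_nonempty_of_subsingleton_image_adjoint (Function.invFun e)
    (fun i k hne u => ?_) hP
  by_cases hk : k ∈ Set.range e
  · obtain ⟨j, rfl⟩ := hk
    rw [Function.leftInverse_invFun e.injective j] at hne
    rw [hL i j hne, map_zero]
    exact Set.subsingleton_singleton.anti (Set.image_subset_iff.2 fun _ _ => rfl)
  · exact (h k hk u).image _

end InclusionSystem

theorem proposition1 {I K : Type*} [Fintype I] [Nonempty I] [Fintype K]
    {H : I → Type*} [∀ i, NormedAddCommGroup (H i)] [∀ i, InnerProductSpace ℝ (H i)]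
    [∀ i, CompleteSpace (H i)]
    {G : K → Type*} [∀ k, NormedAddCommGroup (G k)] [∀ k, InnerProductSpace ℝ (G k)]
    [∀ k, CompleteSpace (G k)]
    (M : InclusionSystem H G) :
    SetOp.MaximallyMonotone M.saddle ∧
    (IsClosed (SetOp.zer M.saddle) ∧ Convex ℝ (SetOp.zer M.saddle)) ∧
    ((∀ p ∈ SetOp.zer M.saddle, (p.fst, p.snd.snd.snd) ∈ M.kuhnTucker) ∧
      M.kuhnTucker ⊆ M.primalSolutions ×ˢ M.dualSolutions) ∧
    ((M.dualSolutions.Nonempty ↔ (SetOp.zer M.saddle).Nonempty) ∧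
      ((SetOp.zer M.saddle).Nonempty ↔ M.kuhnTucker.Nonempty) ∧
      (M.kuhnTucker.Nonempty → M.primalSolutions.Nonempty)) ∧
    ((Fintype.card I = 1 ∨
      (∀ k, SetOp.AtMostSingleValued (SetOp.parallelSum (M.B k) (M.D k))) ∨
      (∀ k, SetOp.StrictlyMonotone (SetOp.inverse (M.D k))) ∨
      -- `I ⊂ K`, the inclusion being given by an injection `e`
      (∃ e : I ↪ K,
        (∀ k, k ∉ Set.range e →
          SetOp.AtMostSingleValued (SetOp.parallelSum (M.B k) (M.D k))) ∧
        ∀ i j : I, j ≠ i → M.L (e j) i = 0)) →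
      (M.primalSolutions.Nonempty → M.kuhnTucker.Nonempty)) := by
  have hS := M.saddle_maximallyMonotone
  have hdual : M.dualSolutions.Nonempty ↔ M.kuhnTucker.Nonempty :=
    ⟨M.kuhnTucker_nonempty_of_dualSolutions_nonempty,
      fun ⟨p, hp⟩ => ⟨p.2, (M.kuhnTucker_subset_prod hp).2⟩⟩
  refine ⟨hS, ⟨hS.isClosed_zer, hS.convex_zer⟩,
    ⟨fun p hp => M.mem_kuhnTucker_of_mem_zer_saddle hp, M.kuhnTucker_subset_prod⟩,
    ⟨hdual.trans M.zer_saddle_nonempty_iff.symm, M.zer_saddle_nonempty_iff,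
      fun ⟨p, hp⟩ => ⟨p.1, (M.kuhnTucker_subset_prod hp).1⟩⟩, ?_⟩
  rintro (hI | hBD | hD | ⟨e, hBD, hL⟩)
  · have := Fintype.card_le_one_iff_subsingleton.1 hI.le
    exact M.kuhnTucker_nonempty_of_subsingleton
  · exact M.kuhnTucker_nonempty_of_atMostSingleValued hBD
  · exact M.kuhnTucker_nonempty_of_atMostSingleValued fun k =>
      (M.B_maximallyMonotone k).atMostSingleValued_parallelSum (hD k)
  · exact M.kuhnTucker_nonempty_of_embedding e hBD hL
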